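/- **Theorem (Inversion for the Neil algebra $\mathfrak{A}$).** Let $\mathbb{T}=\{e^{it}\}$ be the unit circle with normalized arc length $\frac{dt}{2\pi}$, let $L^p=L^p(\mathbb{T})$ and $\hat f(n)=\int_0^{2\pi} f\,e^{-int}\,\frac{dt}{2\pi}$. For $p=2,\infty$ let $H^p=\{f\in L^p:\hat f(n)=0 \text{ for all } n<0\}$, and identify $f\in H^p$ with the holomorphic function $f(z)=\sum_{n\ge 0}\hat f(n)z^n$ on the open unit disc $\mathbb{D}$. Let $\mathfrak{A}=\{\psi\in H^\infty:\psi'(0)=0\}$. An element $\psi\in\mathfrak{A}$ is invertible in $\mathfrak{A}$ if it does not vanish in $\mathbb{D}$ and $1/\psi\in\mathfrak{A}$. Let $\mathbb{B}^2=\{(a,b)\in\mathbb{C}^2:|a|^2+|b|^2=1\}$. For $\alpha=(a,b)\in\mathbb{B}^2$ let $$H^2_\alpha=\{f\in H^2: f(0)\,b=f'(0)\,a\},$$ let $V_\alpha:H^2_\alpha\to L^2$ be the inclusion, and for $\phi\in L^\infty$ let $T^\alpha_\phi=V_\alpha^*M_\phi V_\alpha:H^2_\alpha\to H^2_\alpha$,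 where $M_\phi f=\phi f$ on $L^2$. Suppose $\phi\in L^\infty$ is unimodular, i.e. $|\phi|=1$ almost everywhere. Then 1. the distance in $L^\infty$ from $\phi$ to $\mathfrak{A}$ is strictly less than one if and only if $T^\alpha_\phi$ is left invertible, as a bounded operator on $H^2_\alpha$, for every $\alpha\in\mathbb{B}^2$; 2. the distance in $L^\infty$ from $\phi$ to the set of invertible elements of $\mathfrak{A}$ is strictly less than one if and only if $T^\alpha_\phi$ is invertible, as a bounded operator on $H^2_\alpha$, for every $\alpha\in\mathbb{B}^2$. -/

import Mathlib

open MeasureTheory AddCircle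
open scoped ENNReal Real

namespace NeilAlgebra

noncomputable section

instance factTwoPiPos : Fact (0 < 2 * π) := ⟨Real.two_pi_pos⟩

/-- The unit circle `𝕋`, parametrised by `t ↦ exp (i t)`, `t ∈ ℝ / 2πℤ`. -/
abbrev Torus : Type := AddCircle (2 * π)

/-- Normalised arc length `dt / 2π` on the circle. -/
abbrev arcLength : Measure Torus := haarAddCircle

/-- The space `L^p(𝕋)` of complex valued functions, with respect to `dt / 2π`. -/
abbrev LpT (p : ℝ≥0∞) : Type := Lp ℂ p arcLength

/-- The Fourier coefficient `∫ f(t) exp(-int) dt/2π` of `f ∈ L^p(𝕋)`. -/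
def coeff {p : ℝ≥0∞} (f : LpT p) (n : ℤ) : ℂ := fourierCoeff (f : Torus → ℂ) n

section FourierFacts

variable {p : ℝ≥0∞} [hp : Fact (1 ≤ p)]

theorem integrable_coe (f : LpT p) : Integrable (f : Torus → ℂ) arcLength :=
  (Lp.memLp f).integrable hp.out

theorem coeff_add (f g : LpT p) (n : ℤ) : coeff (f + g) n = coeff f n + coeff g n := by
  unfold coeff
  rw [fourierCoeff_congr_ae (Lp.coeFn_add f g),
    fourierCoeff.add (integrable_coe f) (integrable_coe g), Pi.add_apply]

theorem coeff_smul (c : ℂ) (f : LpT p) (n : ℤ) : coeff (c • f) n = c * coeff f n := by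
  unfold coeff
  rw [fourierCoeff_congr_ae (Lp.coeFn_smul c f), fourierCoeff.const_smul, smul_eq_mul]

theorem norm_coeff_le (f : LpT p) (n : ℤ) : ‖coeff f n‖ ≤ ‖f‖ := by
  have h1 : ‖coeff f n‖ ≤ ∫ t, ‖(f : Torus → ℂ) t‖ ∂arcLength := by
    unfold coeff fourierCoeff
    refine (norm_integral_le_integral_norm _).trans (le_of_eq ?_)
    refine integral_congr_ae (Filter.Eventually.of_forall fun t => ?_)
    simp only [norm_smul, fourier_apply, Circle.norm_coe, one_mul]
  refine h1.trans ?_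
  rw [integral_norm_eq_lintegral_enorm (Lp.aestronglyMeasurable f), ← eLpNorm_one_eq_lintegral_enorm,
    Lp.norm_def]
  exact ENNReal.toReal_mono (Lp.eLpNorm_ne_top f)
    (eLpNorm_le_eLpNorm_of_exponent_le hp.out (Lp.aestronglyMeasurable f))

variable (p) in
/-- The `n`-th Fourier coefficient as a bounded linear functional on `L^p(𝕋)`. -/
def coeffL (n : ℤ) : LpT p →L[ℂ] ℂ :=
  LinearMap.mkContinuous
    { toFun := fun f => coeff f n
      map_add' := fun f g => coeff_add f g n
      map_smul' := fun c f => coeff_smul c f n } 1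
    (fun f => by simpa using norm_coeff_le f n)

theorem coeffL_apply (n : ℤ) (f : LpT p) : coeffL p n f = coeff f n := rfl

end FourierFacts

/-- The Hardy space `H^p(𝕋)`: the `f ∈ L^p(𝕋)` whose negative Fourier coefficients vanish. -/
def hardy (p : ℝ≥0∞) [Fact (1 ≤ p)] : Submodule ℂ (LpT p) where
  carrier := {f | ∀ n : ℤ, n < 0 → coeff f n = 0}
  add_mem' := fun {f g} hf hg n hn => by rw [coeff_add, hf n hn, hg n hn, add_zero]
  zero_mem' := fun n _ => (coeffL p n).map_zero
  smul_mem' := fun c f hf n hn => by rw [coeff_smul, hf n hn, mul_zero]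

/-- The holomorphic function `z ↦ ∑ f̂(n) zⁿ` on the unit disc `𝔻` that corresponds to
`f ∈ H^p(𝕋)` under the identification of `H^p(𝔻)` with `H^p(𝕋)`. -/
def discFun {p : ℝ≥0∞} (f : LpT p) (z : ℂ) : ℂ := ∑' n : ℕ, coeff f n * z ^ n

/-- The open unit disc. -/
abbrev disc : Set ℂ := Metric.ball 0 1

section DiscFacts

variable {p : ℝ≥0∞} [hp : Fact (1 ≤ p)]

theorem discFun_hasFPowerSeriesOnBall (f : LpT p) :
    HasFPowerSeriesOnBall (discFun f)
      (FormalMultilinearSeries.ofScalars ℂ (fun n : ℕ => coeff f n)) 0 1 := by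
  have hr : (1 : ℝ≥0∞) ≤
      (FormalMultilinearSeries.ofScalars ℂ (fun n : ℕ => coeff f n)).radius := by
    have := FormalMultilinearSeries.le_radius_of_bound
      (FormalMultilinearSeries.ofScalars ℂ (fun n : ℕ => coeff f n)) (r := 1) ‖f‖ (fun n => by
        simpa [FormalMultilinearSeries.ofScalars_norm] using norm_coeff_le f n)
    simpa using this
  have h := (FormalMultilinearSeries.hasFPowerSeriesOnBall
    (FormalMultilinearSeries.ofScalars ℂ (fun n : ℕ => coeff f n))
    (lt_of_lt_of_le one_pos hr)).mono one_pos hr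
  refine h.congr fun z _ => ?_
  simp [FormalMultilinearSeries.sum, discFun, mul_comm]

theorem discFun_zero (f : LpT p) : discFun f 0 = coeff f 0 := by
  unfold discFun
  rw [tsum_eq_single 0 (fun n hn => by simp [hn])]
  simp

theorem deriv_discFun_zero (f : LpT p) : deriv (discFun f) 0 = coeff f 1 := by
  rw [(discFun_hasFPowerSeriesOnBall f).hasFPowerSeriesAt.deriv]
  simp

end DiscFacts

/-- The Neil algebra `𝔄`: the `ψ ∈ H^∞` with `ψ'(0) = 0`. -/
def neil : Submodule ℂ (LpT ∞) where
  carrier := {ψ | ψ ∈ hardy ∞ ∧ deriv (discFun ψ) 0 = 0}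
  add_mem' := fun {f g} hf hg => ⟨add_mem hf.1 hg.1, by
    have h1 := hf.2
    have h2 := hg.2
    rw [deriv_discFun_zero] at h1 h2 ⊢
    rw [coeff_add, h1, h2, add_zero]⟩
  zero_mem' := ⟨zero_mem _, by rw [deriv_discFun_zero]; exact (coeffL ∞ 1).map_zero⟩
  smul_mem' := fun c f hf => ⟨Submodule.smul_mem _ c hf.1, by
    have h1 := hf.2
    rw [deriv_discFun_zero] at h1 ⊢
    rw [coeff_smul, h1, mul_zero]⟩

/-- The invertible elements of `𝔄`: the `ψ ∈ 𝔄` without zeros in the disc whose reciprocal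
`1 / ψ` (as a function on the disc) belongs to `𝔄`. -/
def neilInvertible : Set (LpT ∞) :=
  {ψ | ψ ∈ neil ∧ (∀ z ∈ disc, discFun ψ z ≠ 0) ∧
    ∃ η ∈ neil, ∀ z ∈ disc, discFun η z = 1 / discFun ψ z}

theorem coeff_const_one (n : ℤ) :
    coeff (Lp.const ∞ arcLength (1 : ℂ)) n = if n = 0 then 1 else 0 := by
  have h := fourierCoeff_congr_ae (T := 2 * π) (Lp.coeFn_const (p := ∞) (μ := arcLength) (1 : ℂ))
  unfold coeff
  rw [h]
  have h2 := orthonormal_iff_ite.mp (orthonormal_fourier (T := 2 * π)) n 0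
  rw [ContinuousMap.inner_toLp (𝕜 := ℂ) haarAddCircle (fourier n) (fourier 0)] at h2
  rw [← h2]
  unfold fourierCoeff
  refine integral_congr_ae (Filter.Eventually.of_forall fun t => ?_)
  simp

/-- The constant `1` is invertible in `𝔄`; in particular `𝔄` and its set of invertible elements
are nonempty, so that distances to them have their usual meaning. -/
theorem const_one_mem_neilInvertible : Lp.const ∞ arcLength (1 : ℂ) ∈ neilInvertible := by
  have hmem : Lp.const ∞ arcLength (1 : ℂ) ∈ neil :=
    ⟨fun n hn => by rw [coeff_const_one, if_neg hn.ne], by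
      rw [deriv_discFun_zero, coeff_const_one, if_neg one_ne_zero]⟩
  have hone : ∀ z, discFun (Lp.const ∞ arcLength (1 : ℂ)) z = 1 := fun z => by
    unfold discFun
    rw [tsum_eq_single 0 (fun n hn => by
      rw [coeff_const_one, if_neg (by exact_mod_cast hn), zero_mul])]
    simp [coeff_const_one]
  exact ⟨hmem, fun z _ => by simp [hone], _, hmem, fun z _ => by simp [hone]⟩

/-- The parameter set `𝔹² = {(a, b) ∈ ℂ² : |a|² + |b|² = 1}`. -/
def sphere : Set (ℂ × ℂ) := {α | ‖α.1‖ ^ 2 + ‖α.2‖ ^ 2 = 1}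

/-- The space `H²_α = {f ∈ H² : f(0) b = f'(0) a}`, for `α = (a, b)`. -/
def hardyAt (α : ℂ × ℂ) : Submodule ℂ (LpT 2) where
  carrier := {f | f ∈ hardy 2 ∧ discFun f 0 * α.2 = deriv (discFun f) 0 * α.1}
  add_mem' := fun {f g} hf hg => ⟨add_mem hf.1 hg.1, by
    have h1 := hf.2
    have h2 := hg.2
    rw [deriv_discFun_zero, discFun_zero] at h1 h2 ⊢
    rw [coeff_add, coeff_add, add_mul, add_mul, h1, h2]⟩
  zero_mem' := ⟨zero_mem _, by
    rw [deriv_discFun_zero, discFun_zero, ← coeffL_apply, ← coeffL_apply]; simp⟩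
  smul_mem' := fun c f hf => ⟨Submodule.smul_mem _ c hf.1, by
    have h1 := hf.2
    rw [deriv_discFun_zero, discFun_zero] at h1 ⊢
    rw [coeff_smul, coeff_smul, mul_assoc, mul_assoc, h1]⟩

theorem isClosed_hardyAt (α : ℂ × ℂ) : IsClosed (hardyAt α : Set (LpT 2)) := by
  have h : (hardyAt α : Set (LpT 2)) =
      (⋂ n : ℤ, ⋂ _ : n < 0, {f | coeffL 2 n f = 0}) ∩
        {f | coeffL 2 0 f * α.2 = coeffL 2 1 f * α.1} := by
    ext f
    simp only [Set.mem_inter_iff, Set.mem_iInter, Set.mem_ofPred_eq, coeffL_apply]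
    rw [← discFun_zero, ← deriv_discFun_zero]
    rfl
  rw [h]
  refine IsClosed.inter (isClosed_iInter fun n => isClosed_iInter fun _ =>
    isClosed_eq (coeffL 2 n).continuous continuous_const) (isClosed_eq ?_ ?_)
  · exact (coeffL 2 0).continuous.mul continuous_const
  · exact (coeffL 2 1).continuous.mul continuous_const

instance completeSpace_hardyAt (α : ℂ × ℂ) : CompleteSpace (hardyAt α) :=
  (isClosed_hardyAt α).completeSpace_coe

/-- The multiplication operator `M_φ f = φ f` on `L²(𝕋)`, for `φ ∈ L^∞(𝕋)`. -/
def mulOp (φ : LpT ∞) : LpT 2 →L[ℂ] LpT 2 :=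
  (ContinuousLinearMap.mul ℂ ℂ).holderL arcLength ∞ 2 2 φ

theorem mulOp_ae (φ : LpT ∞) (f : LpT 2) :
    (mulOp φ f : Torus → ℂ) =ᵐ[arcLength] fun t => φ t * f t := by
  simpa [mulOp] using (ContinuousLinearMap.mul ℂ ℂ).coeFn_holder (r := 2) φ f

/-- The Toeplitz operator `T^α_φ = V_α^* M_φ V_α` on `H²_α`, where `V_α : H²_α → L²` is the
inclusion. -/
def toeplitz (α : ℂ × ℂ) (φ : LpT ∞) : hardyAt α →L[ℂ] hardyAt α :=
  (ContinuousLinearMap.adjoint (hardyAt α).subtypeL).comp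
    ((mulOp φ).comp (hardyAt α).subtypeL)

end

end NeilAlgebra

/-!
If `ψ ∈ 𝔄` then `M_ψ` maps `H²_α` into itself, so `(T^α_φ)^* T^α_ψ` is the compression to `H²_α` of
multiplication by `φ̄ψ`, which is within `‖φ - ψ‖` of the identity because `φ` is unimodular. If
`‖φ - ψ‖ < 1`, this product is therefore invertible, so `T^α_φ` is left invertible, and it is
invertible exactly when `T^α_ψ` is. If moreover `T^α_ψ` is invertible for `α = (1, 0)`, where
`1 ∈ H²_α`, then the solution `g` of `ψ g = 1` is bounded and is the inverse of `ψ` in `𝔄`.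

Conversely, left invertibility of `T^α_φ` says that the Hankel operator `(1 - P_α) M_φ P_α` has
norm less than one, where `P_α` is the projection onto `H²_α`. Since `P_α` is the projection onto
`z²H²` plus the projection onto the line through `a + bz`, it depends continuously on `α`, and
compactness of `𝔹²` gives a bound `r < 1` valid for all `α`. By duality between `L¹` and `L^∞`, the
distance from `φ` to `𝔄` is at most `r` as soon as `|∫ φ z̄ h| ≤ r ‖h‖₁` for the `h` in the disc
algebra with `h'(0) = 0`. Now factor `h = c q` with `q` zero-free and `|q|²` close to `|h|`. Then
`q ∈ H²_α` for `α` proportional to `(q(0), q'(0))`, and `h'(0) = 0` says exactly that `z c̄` is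
orthogonal to `H²_α`, so `∫ φ z̄ h` is the inner product of `φ q` with `z c̄`, to which the Hankel
bound applies. Letting `α` vary is what makes every such `h` accessible.
-/

namespace NeilAlgebra

noncomputable section

section Compression

open ContinuousLinearMap Submodule

variable {𝕜 H : Type*} [RCLike 𝕜] [NormedAddCommGroup H] [InnerProductSpace 𝕜 H]
  [CompleteSpace H] (K : Submodule 𝕜 H) [CompleteSpace K] {U B : H →L[𝕜] H}

/-- The compression `P_K A|_K` of an operator `A` to a closed subspace `K`. A Toeplitz operator is
the compression of a multiplication operator. -/
def compression (A : H →L[𝕜] H) : K →L[𝕜] K :=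
  adjoint K.subtypeL ∘L A ∘L K.subtypeL

theorem coe_compression_apply (A : H →L[𝕜] H) (f : K) :
    (compression K A f : H) = K.starProjection (A f) := by
  rw [compression, adjoint_subtypeL]
  rfl

theorem coe_compression_apply_of_invariant (hB : ∀ f ∈ K, B f ∈ K) (f : K) :
    (compression K B f : H) = B f := by
  rw [coe_compression_apply, starProjection_eq_self_iff.2 (hB f f.2)]

theorem compression_one : compression K (1 : H →L[𝕜] H) = 1 := by
  ext f
  exact coe_compression_apply_of_invariant K (fun _ hf => hf) f

theorem compression_sub (A B : H →L[𝕜] H) :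
    compression K (A - B) = compression K A - compression K B := by
  ext f
  simp only [coe_compression_apply, sub_apply, map_sub, AddSubgroupClass.coe_sub]

theorem adjoint_compression (A : H →L[𝕜] H) :
    adjoint (compression K A) = compression K (adjoint A) := by
  simp only [compression, adjoint_comp, adjoint_adjoint, comp_assoc]

theorem compression_mul_of_invariant (A : H →L[𝕜] H) (hB : ∀ f ∈ K, B f ∈ K) :
    compression K (A * B) = compression K A * compression K B := by
  ext f
  simp only [mul_apply_eq_comp, coe_compression_apply,
    coe_compression_apply_of_invariant K hB]

theorem norm_compression_le (A : H →L[𝕜] H) : ‖compression K A‖ ≤ ‖A‖ :=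
  opNorm_le_bound _ (norm_nonneg _) fun f => by
    calc ‖compression K A f‖ = ‖K.starProjection (A f)‖ := by
          rw [← coe_compression_apply, Submodule.coe_norm]
      _ ≤ ‖A f‖ := norm_starProjection_apply_le K _
      _ ≤ ‖A‖ * ‖f‖ := A.le_opNorm f

theorem isUnit_adjoint_compression_mul_compression (hU : ∀ f, ‖U f‖ = ‖f‖)
    (hB : ∀ f ∈ K, B f ∈ K) (h : ‖U - B‖ < 1) :
    IsUnit (adjoint (compression K U) * compression K B) := by
  have hU' : adjoint U * U = 1 := (norm_map_iff_adjoint_comp_self U).1 hU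
  have hnorm : ‖adjoint U‖ ≤ 1 := by
    rw [LinearIsometryEquiv.norm_map]
    exact opNorm_le_bound _ zero_le_one fun f => by rw [hU, one_mul]
  have key : 1 - adjoint (compression K U) * compression K B =
      compression K (adjoint U * (U - B)) := by
    rw [adjoint_compression, ← compression_mul_of_invariant K _ hB, mul_sub, hU', compression_sub,
      compression_one]
  have hlt : ‖1 - adjoint (compression K U) * compression K B‖ < 1 := by
    calc ‖1 - adjoint (compression K U) * compression K B‖
        ≤ ‖adjoint U * (U - B)‖ := key ▸ norm_compression_le K _
      _ ≤ 1 * ‖U - B‖ := (opNorm_comp_le _ _).trans (by gcongr)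
      _ < 1 := by rwa [one_mul]
  simpa only [sub_sub_cancel] using isUnit_one_sub_of_norm_lt_one (R := K →L[𝕜] K) hlt

theorem exists_leftInverse_compression (hU : ∀ f, ‖U f‖ = ‖f‖) (hB : ∀ f ∈ K, B f ∈ K)
    (h : ‖U - B‖ < 1) : ∃ S, S * compression K U = 1 := by
  have hunit := (isUnit_adjoint_compression_mul_compression K hU hB h).star
  rw [star_mul, ← star_eq_adjoint, star_star] at hunit
  obtain ⟨S, hS⟩ := hunit.exists_left_inv
  exact ⟨S * star (compression K B), by rw [mul_assoc, hS]⟩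

end Compression

section Hankel

open ContinuousLinearMap Submodule

variable {𝕜 H : Type*} [RCLike 𝕜] [NormedAddCommGroup H] [InnerProductSpace 𝕜 H]
  (K : Submodule 𝕜 H) [K.HasOrthogonalProjection]

/-- The Hankel operator `(1 - P_K) A P_K`: the part of `A` that maps a closed subspace `K` to its
orthogonal complement. -/
def hankel (A : H →L[𝕜] H) : H →L[𝕜] H :=
  Kᗮ.starProjection ∘L A ∘L K.starProjection

theorem hankel_apply_of_mem (A : H →L[𝕜] H) {f : H} (hf : f ∈ K) :
    hankel K A f = Kᗮ.starProjection (A f) := by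
  simp only [hankel, comp_apply, starProjection_eq_self_iff.2 hf]

theorem norm_inner_le_norm_hankel (A : H →L[𝕜] H) {f k : H} (hf : f ∈ K) (hk : k ∈ Kᗮ) :
    ‖inner 𝕜 k (A f)‖ ≤ ‖hankel K A‖ * ‖f‖ * ‖k‖ := by
  have heq : inner 𝕜 k (A f) = inner 𝕜 k (hankel K A f) := by
    rw [hankel_apply_of_mem K A hf, ← inner_starProjection_left_eq_right,
      starProjection_eq_self_iff.2 hk]
  rw [heq, mul_comm]
  exact (norm_inner_le_norm _ _).trans (by gcongr; exact le_opNorm _ _)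

variable [CompleteSpace H] [CompleteSpace K] {U : H →L[𝕜] H}

theorem norm_sq_hankel_apply (hU : ∀ f, ‖U f‖ = ‖f‖) (f : K) :
    ‖hankel K U f‖ ^ 2 = ‖f‖ ^ 2 - ‖compression K U f‖ ^ 2 := by
  have pythagoras := norm_sq_eq_add_norm_sq_starProjection (U f) K
  rw [hU, ← coe_compression_apply, ← hankel_apply_of_mem K U f.2] at pythagoras
  exact eq_sub_of_add_eq' pythagoras.symm

theorem norm_hankel_lt_one (hU : ∀ f, ‖U f‖ = ‖f‖) {S : K →L[𝕜] K}
    (hS : S * compression K U = 1) : ‖hankel K U‖ < 1 := by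
  set c : ℝ := (‖S‖ + 1)⁻¹ with hc
  have hc0 : 0 < c := by positivity
  have hc1 : c ≤ 1 := inv_le_one_of_one_le₀ (by linarith [norm_nonneg S])
  have below (f : K) : c * ‖f‖ ≤ ‖compression K U f‖ := by
    have hSf : S (compression K U f) = f := congrArg (fun A : K →L[𝕜] K => A f) hS
    rw [hc, inv_mul_le_iff₀ (by positivity)]
    calc ‖f‖ = ‖S (compression K U f)‖ := by rw [hSf]
      _ ≤ ‖S‖ * ‖compression K U f‖ := S.le_opNorm _
      _ ≤ (‖S‖ + 1) * ‖compression K U f‖ := by gcongr; linarith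
  have hc2 : 0 ≤ 1 - c ^ 2 := by nlinarith
  have hle : ‖hankel K U‖ ≤ √(1 - c ^ 2) := by
    refine opNorm_le_bound _ (Real.sqrt_nonneg _) fun x => ?_
    set f := K.orthogonalProjectionOnto x
    have hfx : ‖f‖ ≤ ‖x‖ := norm_starProjection_apply_le K x
    have hH : hankel K U x = hankel K U f := by
      simp only [hankel, comp_apply, starProjection_eq_self_iff.2 f.2]
      rfl
    refine abs_le_of_sq_le_sq' ?_ (by positivity) |>.2
    calc ‖hankel K U x‖ ^ 2 = ‖f‖ ^ 2 - ‖compression K U f‖ ^ 2 := by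
          rw [hH, norm_sq_hankel_apply K hU]
      _ ≤ ‖f‖ ^ 2 - (c * ‖f‖) ^ 2 := by gcongr; exact below f
      _ = (1 - c ^ 2) * ‖f‖ ^ 2 := by ring
      _ ≤ (1 - c ^ 2) * ‖x‖ ^ 2 := by gcongr
      _ = (√(1 - c ^ 2) * ‖x‖) ^ 2 := by rw [mul_pow, Real.sq_sqrt hc2]
  refine hle.trans_lt ?_
  rw [Real.sqrt_lt' one_pos]
  nlinarith

end Hankel

section OrthogonalSum

open Submodule

variable {𝕜 H : Type*} [RCLike 𝕜] [NormedAddCommGroup H] [InnerProductSpace 𝕜 H]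
  {K M N : Submodule 𝕜 H} [K.HasOrthogonalProjection] [M.HasOrthogonalProjection]
  [N.HasOrthogonalProjection]

theorem starProjection_eq_add_of_sup_eq (hMN : M ⟂ N) (hK : M ⊔ N = K) :
    K.starProjection = M.starProjection + N.starProjection := by
  subst hK
  ext x
  rw [add_apply]
  have hM := M.starProjection_apply_mem x
  have hN := N.starProjection_apply_mem x
  refine eq_starProjection_of_mem_orthogonal (add_mem_sup hM hN) ?_
  rw [← inf_orthogonal, mem_inf]
  constructor
  · rw [← sub_sub]
    exact sub_mem (sub_starProjection_mem_orthogonal x) (isOrtho_iff_le.1 hMN.symm hN)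
  · rw [add_comm, ← sub_sub]
    exact sub_mem (sub_starProjection_mem_orthogonal x) (isOrtho_iff_le.1 hMN hM)

end OrthogonalSum

section LebesgueSpaces

open ContinuousLinearMap

variable {X E : Type*} [MeasurableSpace X] {μ : Measure X} [NormedAddCommGroup E]

theorem ae_norm_le_norm (f : Lp E ∞ μ) : ∀ᵐ x ∂μ, ‖f x‖ ≤ ‖f‖ := by
  filter_upwards [ae_le_eLpNormEssSup (f := f) (μ := μ)] with x hx
  rw [Lp.norm_def, eLpNorm_exponent_top, ← toReal_enorm]
  refine ENNReal.toReal_mono ?_ hx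
  rw [← eLpNorm_exponent_top]
  exact Lp.eLpNorm_ne_top f

theorem ae_norm_le_of_setIntegral_sq_le [IsFiniteMeasure μ] (v : Lp E 2 μ) {C : ℝ} (hC : 0 ≤ C)
    (h : ∀ s, MeasurableSet s → ∫ x in s, ‖v x‖ ^ 2 ∂μ ≤ C * ∫ x in s, ‖v x‖ ∂μ) :
    ∀ᵐ x ∂μ, ‖v x‖ ≤ C := by
  have hsq : Integrable (fun x => ‖v x‖ ^ 2) μ := (Lp.memLp v).norm.integrable_sq
  have hmul : Integrable (fun x => C * ‖v x‖) μ :=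
    ((Lp.memLp v).integrable one_le_two).norm.const_mul C
  have hle : ∀ᵐ x ∂μ, ‖v x‖ ^ 2 ≤ C * ‖v x‖ := by
    refine ae_le_of_forall_setIntegral_le hsq hmul fun s hs _ => ?_
    rw [integral_const_mul]
    exact h s hs
  filter_upwards [hle] with x hx
  by_contra! hlt
  nlinarith

variable {𝕜 : Type*} [RCLike 𝕜]

/-- The duality pairing `⟨φ, f⟩ = ∫ φ f dμ` between `L^∞` and `L¹`; it is bilinear, without a
complex conjugate. -/
def pairing : Lp 𝕜 ∞ μ →L[𝕜] Lp 𝕜 1 μ →L[𝕜] 𝕜 :=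
  haveI : ENNReal.HolderConjugate ∞ 1 := ENNReal.HolderConjugate.top_one
  (mul 𝕜 𝕜).lpPairing μ ∞ 1

theorem pairing_apply (φ : Lp 𝕜 ∞ μ) (f : Lp 𝕜 1 μ) : pairing φ f = ∫ x, φ x * f x ∂μ :=
  haveI : ENNReal.HolderConjugate ∞ 1 := ENNReal.HolderConjugate.top_one
  (mul 𝕜 𝕜).lpPairing_eq_integral φ f

variable [IsFiniteMeasure μ]

/-- The inclusion of `L²` into `L¹` over a finite measure space, written as multiplication by
the constant function `1 ∈ L²`, so that its continuity is Hölder's inequality. -/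
def inclOne : Lp 𝕜 2 μ →L[𝕜] Lp 𝕜 1 μ :=
  (mul 𝕜 𝕜).holderL μ 2 2 1 (Lp.const 2 μ 1)

theorem inclOne_ae (f : Lp 𝕜 2 μ) : inclOne f =ᵐ[μ] f := by
  filter_upwards [(mul 𝕜 𝕜).coeFn_holder (r := 1) (Lp.const 2 μ (1 : 𝕜)) f,
    Lp.coeFn_const (p := 2) (μ := μ) (1 : 𝕜)] with x hx hone
  rw [inclOne, holderL_apply_apply, hx, hone, mul_apply', Function.const_apply, one_mul]

theorem setIntegral_sq_le_of_inner_eq {g : Lp 𝕜 1 μ →L[𝕜] 𝕜} {v : Lp 𝕜 2 μ}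
    (hv : ∀ f, inner 𝕜 v f = g (inclOne f)) {s : Set X} (hs : MeasurableSet s) :
    ∫ x in s, ‖v x‖ ^ 2 ∂μ ≤ ‖g‖ * ∫ x in s, ‖v x‖ ∂μ := by
  have hmem : MemLp (s.indicator v) 2 μ := (Lp.memLp v).indicator hs
  set u : Lp 𝕜 2 μ := hmem.toLp
  have hu : u =ᵐ[μ] s.indicator v := hmem.coeFn_toLp
  have hinner : inner 𝕜 v u = ((∫ x in s, ‖v x‖ ^ 2 ∂μ : ℝ) : 𝕜) := by
    rw [L2.inner_def, ← integral_indicator hs, ← integral_ofReal]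
    refine integral_congr_ae ?_
    filter_upwards [hu] with x hx
    rw [hx]
    by_cases hxs : x ∈ s <;> simp [hxs]
  have hnorm : ‖inclOne u‖ = ∫ x in s, ‖v x‖ ∂μ := by
    rw [L1.norm_eq_integral_norm, ← integral_indicator hs]
    refine integral_congr_ae ?_
    filter_upwards [inclOne_ae u, hu] with x hx hxu
    rw [hx, hxu, norm_indicator_eq_indicator_norm]
  calc ∫ x in s, ‖v x‖ ^ 2 ∂μ ≤ ‖((∫ x in s, ‖v x‖ ^ 2 ∂μ : ℝ) : 𝕜)‖ := by
        rw [RCLike.norm_ofReal]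
        exact le_abs_self _
    _ = ‖g (inclOne u)‖ := by rw [← hinner, hv]
    _ ≤ ‖g‖ * ∫ x in s, ‖v x‖ ∂μ := hnorm ▸ g.le_opNorm _

theorem ext_inclOne {g h : Lp 𝕜 1 μ →L[𝕜] 𝕜} (hgh : ∀ f, g (inclOne f) = h (inclOne f)) :
    g = h := by
  ext f
  induction f using Lp.induction ENNReal.one_ne_top with
  | indicatorConst c hs hμs =>
    have hincl : inclOne (indicatorConstLp 2 hs hμs.ne c) = indicatorConstLp 1 hs hμs.ne c :=
      Lp.ext ((inclOne_ae _).trans (indicatorConstLp_coeFn.trans indicatorConstLp_coeFn.symm))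
    rw [Lp.simpleFunc.coe_indicatorConst, ← hincl, hgh]
  | add hf hf' _ h₁ h₂ => rw [map_add, map_add, h₁, h₂]
  | isClosed => exact isClosed_eq g.continuous h.continuous

theorem exists_pairing_eq (g : Lp 𝕜 1 μ →L[𝕜] 𝕜) :
    ∃ χ : Lp 𝕜 ∞ μ, ‖χ‖ ≤ ‖g‖ ∧ pairing χ = g := by
  set v : Lp 𝕜 2 μ := (InnerProductSpace.toDual 𝕜 (Lp 𝕜 2 μ)).symm (g ∘L inclOne)
  have hv (f : Lp 𝕜 2 μ) : inner 𝕜 v f = g (inclOne f) := InnerProductSpace.toDual_symm_apply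
  have hbound := ae_norm_le_of_setIntegral_sq_le v (norm_nonneg g)
    fun _ => setIntegral_sq_le_of_inner_eq hv
  have hmem : MemLp (star (v : X → 𝕜)) ∞ μ :=
    memLp_top_of_bound (RCLike.continuous_conj.comp_aestronglyMeasurable
      (Lp.aestronglyMeasurable v)) ‖g‖ (by simpa using hbound)
  refine ⟨hmem.toLp, ?_, ext_inclOne fun f => ?_⟩
  · have hle := Lp.norm_le_of_ae_bound (norm_nonneg g) (f := hmem.toLp) <| by
      filter_upwards [hmem.coeFn_toLp, hbound] with x hx hxg
      rwa [hx, Pi.star_apply, norm_star]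
    rwa [ENNReal.toReal_top, inv_zero, Real.rpow_zero, one_mul] at hle
  · rw [← hv, pairing_apply, L2.inner_def]
    refine integral_congr_ae ?_
    filter_upwards [hmem.coeFn_toLp, inclOne_ae f] with x hx hfx
    rw [hx, hfx, RCLike.inner_apply, mul_comm]
    rfl

theorem exists_norm_sub_le_pairing_eq_zero (φ : Lp 𝕜 ∞ μ) (W : Submodule 𝕜 (Lp 𝕜 1 μ)) {r : ℝ}
    (hr : 0 ≤ r) (h : ∀ w ∈ W, ‖pairing φ w‖ ≤ r * ‖w‖) :
    ∃ ψ, ‖φ - ψ‖ ≤ r ∧ ∀ w ∈ W, pairing ψ w = 0 := by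
  obtain ⟨g, hg, hgnorm⟩ := exists_extension_norm_eq W (pairing φ ∘L W.subtypeL)
  obtain ⟨χ, hχ, rfl⟩ := exists_pairing_eq g
  refine ⟨φ - χ, ?_, fun w hw => ?_⟩
  · rw [sub_sub_cancel]
    exact hχ.trans (hgnorm.trans_le (opNorm_le_bound _ hr fun w => h w w.2))
  · rw [map_sub, sub_apply, hg ⟨w, hw⟩, comp_apply, Submodule.subtypeL_apply, sub_self]

end LebesgueSpaces

section Coefficients

variable {p : ℝ≥0∞} [Fact (1 ≤ p)]

theorem coeff_sub (f g : LpT p) (n : ℤ) : coeff (f - g) n = coeff f n - coeff g n :=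
  map_sub (coeffL p n) f g

theorem coeff_toLp (q : C(Torus, ℂ)) (n : ℤ) :
    coeff (ContinuousMap.toLp p arcLength ℂ q) n = fourierCoeff q n :=
  congrFun (fourierCoeff_congr_ae (ContinuousMap.coeFn_toLp arcLength q)) n

theorem coeff_eq_inner (f : LpT 2) (n : ℤ) : coeff f n = inner ℂ (fourierLp 2 n) f := by
  have h := fourierBasis_repr (T := 2 * π) f n
  rw [HilbertBasis.repr_apply_apply, coe_fourierBasis] at h
  exact h.symm

theorem ext_coeff {f g : LpT 2} (h : ∀ n, coeff f n = coeff g n) : f = g := by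
  apply (fourierBasis (T := 2 * π)).repr.injective
  ext n
  rw [fourierBasis_repr, fourierBasis_repr]
  exact h n

theorem coeff_fourierLp (k n : ℤ) :
    coeff (fourierLp 2 k : LpT 2) n = if n = k then 1 else 0 := by
  rw [coeff_eq_inner]
  exact orthonormal_iff_ite.mp (orthonormal_fourier (T := 2 * π)) n k

theorem fourierLp_mem_hardy {k : ℤ} (hk : 0 ≤ k) : (fourierLp 2 k : LpT 2) ∈ hardy 2 :=
  fun n hn => by rw [coeff_fourierLp, if_neg (by lia)]

theorem mem_neil {ψ : LpT ∞} : ψ ∈ neil ↔ ψ ∈ hardy ∞ ∧ coeff ψ 1 = 0 := by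
  rw [← deriv_discFun_zero]; rfl

theorem mem_hardyAt {α : ℂ × ℂ} {f : LpT 2} :
    f ∈ hardyAt α ↔ f ∈ hardy 2 ∧ coeff f 0 * α.2 = coeff f 1 * α.1 := by
  rw [← deriv_discFun_zero, ← discFun_zero]; rfl

theorem fourierLp_zero_mem_hardyAt : (fourierLp 2 0 : LpT 2) ∈ hardyAt (1, 0) :=
  mem_hardyAt.2 ⟨fourierLp_mem_hardy le_rfl, by simp [coeff_fourierLp]⟩

end Coefficients

section Multiplication

theorem norm_mulOp_le (φ : LpT ∞) : ‖mulOp φ‖ ≤ ‖φ‖ := by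
  refine ContinuousLinearMap.opNorm_le_bound _ (norm_nonneg _) fun f => ?_
  refine ((ContinuousLinearMap.mul ℂ ℂ).norm_holder_apply_apply_le (r := 2) φ f).trans ?_
  simp

theorem norm_mulOp_sub_le (φ ψ : LpT ∞) : ‖mulOp φ - mulOp ψ‖ ≤ ‖φ - ψ‖ := by
  have h : mulOp φ - mulOp ψ = mulOp (φ - ψ) := (map_sub _ φ ψ).symm
  exact h ▸ norm_mulOp_le _

theorem norm_mulOp_apply {φ : LpT ∞} (hφ : ∀ᵐ t ∂arcLength, ‖φ t‖ = 1) (f : LpT 2) :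
    ‖mulOp φ f‖ = ‖f‖ := by
  rw [Lp.norm_def, Lp.norm_def]
  refine congrArg ENNReal.toReal (eLpNorm_congr_norm_ae ?_)
  filter_upwards [hφ, mulOp_ae φ f] with t hφt hft
  rw [hft, norm_mul, hφt, one_mul]

theorem mulOp_fourierLp_zero_ae (ψ : LpT ∞) :
    (mulOp ψ (fourierLp 2 0) : Torus → ℂ) =ᵐ[arcLength] ψ := by
  filter_upwards [mulOp_ae ψ (fourierLp 2 0), coeFn_fourierLp (T := 2 * π) 2 0] with t hψ hone
  rw [hψ, hone, fourier_zero, mul_one]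

theorem mulOp_eq_fourierLp_zero_iff {ψ : LpT ∞} {f : LpT 2} :
    mulOp ψ f = fourierLp 2 0 ↔ ∀ᵐ t ∂arcLength, ψ t * f t = 1 := by
  rw [Lp.ext_iff]
  have hone := coeFn_fourierLp (T := 2 * π) 2 0
  constructor <;> intro h
  · filter_upwards [h, mulOp_ae ψ f, hone] with t ht hψ ht1
    rw [← hψ, ht, ht1, fourier_zero]
  · filter_upwards [h, mulOp_ae ψ f, hone] with t ht hψ ht1
    rw [hψ, ht, ht1, fourier_zero]

theorem coeff_mulOp_fourierLp (ψ : LpT ∞) (k n : ℤ) :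
    coeff (mulOp ψ (fourierLp 2 k)) n = coeff ψ (n - k) := by
  unfold coeff fourierCoeff
  refine integral_congr_ae ?_
  filter_upwards [mulOp_ae ψ (fourierLp 2 k), coeFn_fourierLp (T := 2 * π) 2 k] with t hψ hk
  rw [hψ, hk, show -(n - k) = -n + k by ring, fourier_add, smul_eq_mul, smul_eq_mul]
  ring

theorem coeff_mulOp_fourierLp_zero (ψ : LpT ∞) (n : ℤ) :
    coeff (mulOp ψ (fourierLp 2 0)) n = coeff ψ n := by
  rw [coeff_mulOp_fourierLp, sub_zero]

theorem mulOp_fourierLp_zero_mem_hardy {ψ : LpT ∞} :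
    mulOp ψ (fourierLp 2 0) ∈ hardy 2 ↔ ψ ∈ hardy ∞ :=
  forall₂_congr fun n _ => by rw [coeff_mulOp_fourierLp_zero]

theorem hasSum_coeff_mulOp (ψ : LpT ∞) (f : LpT 2) (n : ℤ) :
    HasSum (fun k : ℤ => coeff f k * coeff ψ (n - k)) (coeff (mulOp ψ f) n) := by
  refine (((coeffL 2 n).comp (mulOp ψ)).hasSum (hasSum_fourier_series_L2 f)).congr_fun fun k => ?_
  rw [ContinuousLinearMap.comp_apply, map_smul, map_smul, coeffL_apply, coeff_mulOp_fourierLp,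
    smul_eq_mul, coeff]

variable {ψ : LpT ∞} {f : LpT 2}

theorem mulOp_mem_hardy (hψ : ψ ∈ hardy ∞) (hf : f ∈ hardy 2) : mulOp ψ f ∈ hardy 2 := by
  intro n hn
  refine (hasSum_coeff_mulOp ψ f n).unique ?_
  convert hasSum_zero using 2 with k
  rcases lt_or_ge k 0 with hk | hk
  · rw [hf k hk, zero_mul]
  · rw [hψ (n - k) (by lia), mul_zero]

theorem coeff_mulOp_of_hardy (hψ : ψ ∈ hardy ∞) (hf : f ∈ hardy 2) (n : ℕ) :
    coeff (mulOp ψ f) n = ∑ k ∈ Finset.range (n + 1), coeff f k * coeff ψ (n - k : ℕ) := by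
  have hzero : ∀ k ∉ (Finset.range (n + 1)).map (Nat.castEmbedding (R := ℤ)),
      coeff f k * coeff ψ (n - k) = 0 := by
    intro k hk
    rcases lt_or_ge k 0 with hk0 | hk0
    · rw [hf k hk0, zero_mul]
    · lift k to ℕ using hk0
      have hnk : n < k := by simpa using hk
      rw [hψ _ (by lia), mul_zero]
  have hsum := hasSum_sum_of_ne_finset_zero (L := SummationFilter.unconditional ℤ) hzero
  rw [(hasSum_coeff_mulOp ψ f n).unique hsum, Finset.sum_map]
  refine Finset.sum_congr rfl fun k hk => ?_
  rw [Nat.castEmbedding_apply, Nat.cast_sub (Finset.mem_range_succ_iff.1 hk)]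

theorem coeff_mulOp_zero (hψ : ψ ∈ hardy ∞) (hf : f ∈ hardy 2) :
    coeff (mulOp ψ f) 0 = coeff f 0 * coeff ψ 0 := by
  simpa using coeff_mulOp_of_hardy hψ hf 0

theorem coeff_mulOp_one (hψ : ψ ∈ hardy ∞) (hf : f ∈ hardy 2) :
    coeff (mulOp ψ f) 1 = coeff f 0 * coeff ψ 1 + coeff f 1 * coeff ψ 0 := by
  simpa [Finset.sum_range_succ] using coeff_mulOp_of_hardy hψ hf 1

theorem mulOp_mem_hardyAt {α : ℂ × ℂ} (hψ : ψ ∈ neil) (hf : f ∈ hardyAt α) :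
    mulOp ψ f ∈ hardyAt α := by
  rw [mem_neil] at hψ
  rw [mem_hardyAt] at hf ⊢
  refine ⟨mulOp_mem_hardy hψ.1 hf.1, ?_⟩
  rw [coeff_mulOp_zero hψ.1 hf.1, coeff_mulOp_one hψ.1 hf.1, hψ.2]
  linear_combination coeff ψ 0 * hf.2

end Multiplication

section DiscFunction

theorem summable_norm_discFun {p : ℝ≥0∞} [Fact (1 ≤ p)] (f : LpT p) {z : ℂ} (hz : z ∈ disc) :
    Summable fun n : ℕ => ‖coeff f n * z ^ n‖ := by
  have hz' : ‖z‖ < 1 := mem_ball_zero_iff.1 hz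
  refine Summable.of_nonneg_of_le (fun n => norm_nonneg _) (fun n => ?_)
    ((summable_geometric_of_lt_one (norm_nonneg z) hz').mul_left ‖f‖)
  rw [norm_mul, norm_pow]
  gcongr
  exact norm_coeff_le f n

theorem discFun_mulOp {ψ : LpT ∞} {f : LpT 2} (hψ : ψ ∈ hardy ∞) (hf : f ∈ hardy 2)
    {z : ℂ} (hz : z ∈ disc) : discFun (mulOp ψ f) z = discFun ψ z * discFun f z := by
  rw [mul_comm (discFun ψ z)]
  unfold discFun
  rw [tsum_mul_tsum_eq_tsum_sum_range_of_summable_norm (summable_norm_discFun f hz)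
    (summable_norm_discFun ψ hz)]
  refine tsum_congr fun n => ?_
  rw [coeff_mulOp_of_hardy hψ hf, Finset.sum_mul]
  refine Finset.sum_congr rfl fun k hk => ?_
  rw [← pow_mul_pow_sub z (Finset.mem_range_succ_iff.1 hk)]
  ring

theorem eq_of_discFun_eq {f g : LpT 2} (hf : f ∈ hardy 2) (hg : g ∈ hardy 2)
    (h : ∀ z ∈ disc, discFun f z = discFun g z) : f = g := by
  have hf' := (discFun_hasFPowerSeriesOnBall f).hasFPowerSeriesAt
  have hg' := (discFun_hasFPowerSeriesOnBall g).hasFPowerSeriesAt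
  have hseries := (hf'.congr (Filter.eventually_of_mem
    (Metric.ball_mem_nhds 0 one_pos) h)).eq_formalMultilinearSeries hg'
  refine ext_coeff fun n => ?_
  rcases lt_or_ge n 0 with hn | hn
  · rw [hf n hn, hg n hn]
  · lift n to ℕ using hn
    simpa using congrArg (fun p => p.coeff n) hseries

theorem discFun_fourierLp_zero (z : ℂ) : discFun (fourierLp 2 0 : LpT 2) z = 1 := by
  unfold discFun
  rw [tsum_eq_single 0 (fun n hn => by
    rw [coeff_fourierLp, if_neg (Nat.cast_ne_zero.2 hn), zero_mul])]
  simp [coeff_fourierLp]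

theorem discFun_mulOp_fourierLp_zero (ψ : LpT ∞) :
    discFun (mulOp ψ (fourierLp 2 0)) = discFun ψ := by
  funext z
  simp only [discFun, coeff_mulOp_fourierLp_zero]

theorem ae_mul_eq_one_iff_discFun {ψ η : LpT ∞} (hψ : ψ ∈ hardy ∞) (hη : η ∈ hardy ∞) :
    (∀ᵐ t ∂arcLength, ψ t * η t = 1) ↔ ∀ z ∈ disc, discFun ψ z * discFun η z = 1 := by
  have hη' := mulOp_fourierLp_zero_mem_hardy.2 hη
  have hdisc : ∀ z ∈ disc, discFun (mulOp ψ (mulOp η (fourierLp 2 0))) z =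
      discFun ψ z * discFun η z := fun z hz => by
    rw [discFun_mulOp hψ hη' hz, discFun_mulOp_fourierLp_zero]
  calc (∀ᵐ t ∂arcLength, ψ t * η t = 1)
      ↔ mulOp ψ (mulOp η (fourierLp 2 0)) = fourierLp 2 0 := by
        rw [mulOp_eq_fourierLp_zero_iff]
        exact Filter.eventually_congr ((mulOp_fourierLp_zero_ae η).mono fun t ht => by rw [ht])
    _ ↔ ∀ z ∈ disc, discFun ψ z * discFun η z = 1 := by
        refine ⟨fun h z hz => ?_, fun h => ?_⟩
        · rw [← hdisc z hz, h, discFun_fourierLp_zero]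
        · refine eq_of_discFun_eq (mulOp_mem_hardy hψ hη') (fourierLp_mem_hardy le_rfl)
            fun z hz => ?_
          rw [hdisc z hz, h z hz, discFun_fourierLp_zero]

theorem mem_neilInvertible_iff {ψ : LpT ∞} :
    ψ ∈ neilInvertible ↔ ψ ∈ neil ∧ ∃ η ∈ neil, ∀ᵐ t ∂arcLength, ψ t * η t = 1 := by
  refine and_congr_right fun hψ => ?_
  constructor
  · rintro ⟨hne, η, hη, hinv⟩
    refine ⟨η, hη, (ae_mul_eq_one_iff_discFun hψ.1 hη.1).2 fun z hz => ?_⟩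
    rw [hinv z hz, mul_one_div_cancel (hne z hz)]
  · rintro ⟨η, hη, hmul⟩
    have hdisc := (ae_mul_eq_one_iff_discFun hψ.1 hη.1).1 hmul
    exact ⟨fun z hz => left_ne_zero_of_mul_eq_one (hdisc z hz), η, hη,
      fun z hz => eq_one_div_of_mul_eq_one_right (hdisc z hz)⟩

end DiscFunction

section Toeplitz

variable {φ ψ : LpT ∞}

theorem isUnit_adjoint_toeplitz_mul_toeplitz (hφ : ∀ᵐ t ∂arcLength, ‖φ t‖ = 1) (α : ℂ × ℂ)
    (hψ : ψ ∈ neil) (h : ‖φ - ψ‖ < 1) :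
    IsUnit (ContinuousLinearMap.adjoint (toeplitz α φ) * toeplitz α ψ) :=
  isUnit_adjoint_compression_mul_compression (hardyAt α) (norm_mulOp_apply hφ)
    (fun _ => mulOp_mem_hardyAt hψ) ((norm_mulOp_sub_le φ ψ).trans_lt h)

theorem exists_leftInverse_toeplitz (hφ : ∀ᵐ t ∂arcLength, ‖φ t‖ = 1) (α : ℂ × ℂ)
    (hψ : ψ ∈ neil) (h : ‖φ - ψ‖ < 1) : ∃ S, S * toeplitz α φ = 1 :=
  exists_leftInverse_compression (hardyAt α) (norm_mulOp_apply hφ)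
    (fun _ => mulOp_mem_hardyAt hψ) ((norm_mulOp_sub_le φ ψ).trans_lt h)

theorem coe_toeplitz_apply_of_mem_neil {α : ℂ × ℂ} (hψ : ψ ∈ neil) (f : hardyAt α) :
    (toeplitz α ψ f : LpT 2) = mulOp ψ f :=
  coe_compression_apply_of_invariant (hardyAt α) (fun _ => mulOp_mem_hardyAt hψ) f

theorem toeplitz_mul_toeplitz_eq_one {α : ℂ × ℂ} {η : LpT ∞} (hψ : ψ ∈ neil) (hη : η ∈ neil)
    (h : ∀ᵐ t ∂arcLength, ψ t * η t = 1) : toeplitz α ψ * toeplitz α η = 1 := by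
  ext1 f
  apply Subtype.ext
  rw [mul_apply_eq_comp, coe_toeplitz_apply_of_mem_neil hψ, coe_toeplitz_apply_of_mem_neil hη,
    one_apply_eq_self]
  refine Lp.ext ?_
  filter_upwards [h, mulOp_ae ψ (mulOp η f), mulOp_ae η f] with t ht hψt hηt
  rw [hψt, hηt, ← mul_assoc, ht, one_mul]

theorem isUnit_toeplitz_of_mem_neilInvertible (α : ℂ × ℂ) (hψ : ψ ∈ neilInvertible) :
    IsUnit (toeplitz α ψ) := by
  obtain ⟨hψ, η, hη, h⟩ := mem_neilInvertible_iff.1 hψ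
  have h' : ∀ᵐ t ∂arcLength, η t * ψ t = 1 := h.mono fun t ht => by rw [mul_comm, ht]
  exact ⟨⟨_, _, toeplitz_mul_toeplitz_eq_one hψ hη h, toeplitz_mul_toeplitz_eq_one hη hψ h'⟩, rfl⟩

theorem isUnit_toeplitz_iff_of_norm_sub_lt_one (hφ : ∀ᵐ t ∂arcLength, ‖φ t‖ = 1) (α : ℂ × ℂ)
    (hψ : ψ ∈ neil) (h : ‖φ - ψ‖ < 1) : IsUnit (toeplitz α φ) ↔ IsUnit (toeplitz α ψ) := by
  have hunit := isUnit_adjoint_toeplitz_mul_toeplitz hφ α hψ h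
  rw [← ContinuousLinearMap.star_eq_adjoint] at hunit
  exact ⟨fun hT => hT.star.mul_left_iff.1 hunit,
    fun hT => isUnit_star.1 (hT.mul_right_iff.1 hunit)⟩

theorem ae_norm_le_inv_of_ae_mul_eq_one (hφ : ∀ᵐ t ∂arcLength, ‖φ t‖ = 1) (h : ‖φ - ψ‖ < 1)
    {g : Torus → ℂ} (hg : ∀ᵐ t ∂arcLength, ψ t * g t = 1) :
    ∀ᵐ t ∂arcLength, ‖g t‖ ≤ (1 - ‖φ - ψ‖)⁻¹ := by
  filter_upwards [hg, hφ, Lp.coeFn_sub φ ψ, ae_norm_le_norm (φ - ψ)] with t hgt hφt hsub hle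
  rw [hsub, Pi.sub_apply] at hle
  have hψt : 1 - ‖φ - ψ‖ ≤ ‖ψ t‖ := by linarith [norm_sub_norm_le (φ t) (ψ t)]
  have hmul : ‖ψ t‖ * ‖g t‖ = 1 := by rw [← norm_mul, hgt, norm_one]
  rw [eq_inv_of_mul_eq_one_right hmul]
  exact inv_anti₀ (sub_pos.2 h) hψt

theorem mem_neilInvertible_of_isUnit_toeplitz (hφ : ∀ᵐ t ∂arcLength, ‖φ t‖ = 1)
    (hψ : ψ ∈ neil) (h : ‖φ - ψ‖ < 1) (hT : IsUnit (toeplitz (1, 0) ψ)) :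
    ψ ∈ neilInvertible := by
  obtain ⟨S, hS⟩ := hT.exists_right_inv
  set g := S ⟨fourierLp 2 0, fourierLp_zero_mem_hardyAt⟩
  have hψg : mulOp ψ g = fourierLp 2 0 := by
    rw [← coe_toeplitz_apply_of_mem_neil hψ, ← mul_apply_eq_comp, hS, one_apply_eq_self]
  have hmul := mulOp_eq_fourierLp_zero_iff.1 hψg
  let η : LpT ∞ := (memLp_top_of_bound (Lp.aestronglyMeasurable _) _
    (ae_norm_le_inv_of_ae_mul_eq_one hφ h hmul)).toLp
  have hηg : η =ᵐ[arcLength] (g : LpT 2) := MemLp.coeFn_toLp _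
  have hη (n : ℤ) : coeff η n = coeff (g : LpT 2) n := congrFun (fourierCoeff_congr_ae hηg) n
  have hg := mem_hardyAt.1 g.2
  refine mem_neilInvertible_iff.2 ⟨hψ, η, mem_neil.2 ⟨fun n hn => ?_, ?_⟩, ?_⟩
  · rw [hη, hg.1 n hn]
  · rw [hη]
    simpa only [mul_zero, mul_one] using hg.2.symm
  · filter_upwards [hmul, hηg] with t ht hηt
    rw [hηt, ht]

end Toeplitz

section UniformHankelBound

/-- The polynomial `a + b z ∈ H²`, for `α = (a, b)`. It spans `H²_α` modulo `z² H²` if `α ∈ 𝔹²`. -/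
def linearPoly (α : ℂ × ℂ) : LpT 2 := α.1 • fourierLp 2 0 + α.2 • fourierLp 2 1

theorem coeff_linearPoly (α : ℂ × ℂ) (n : ℤ) :
    coeff (linearPoly α) n = α.1 * (if n = 0 then 1 else 0) + α.2 * (if n = 1 then 1 else 0) := by
  rw [linearPoly, coeff_add, coeff_smul, coeff_smul, coeff_fourierLp, coeff_fourierLp]

theorem inner_linearPoly (α : ℂ × ℂ) (f : LpT 2) :
    inner ℂ (linearPoly α) f =
      (starRingEnd ℂ) α.1 * coeff f 0 + (starRingEnd ℂ) α.2 * coeff f 1 := by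
  rw [linearPoly, inner_add_left, inner_smul_left, inner_smul_left, coeff_eq_inner,
    coeff_eq_inner]

theorem linearPoly_mem_hardyAt (α : ℂ × ℂ) : linearPoly α ∈ hardyAt α := by
  refine mem_hardyAt.2 ⟨?_, by simp [coeff_linearPoly, mul_comm]⟩
  exact add_mem (Submodule.smul_mem _ _ (fourierLp_mem_hardy le_rfl))
    (Submodule.smul_mem _ _ (fourierLp_mem_hardy zero_le_one))

theorem conj_mul_add_conj_mul_of_mem_sphere {α : ℂ × ℂ} (hα : α ∈ sphere) :
    (starRingEnd ℂ) α.1 * α.1 + (starRingEnd ℂ) α.2 * α.2 = 1 := by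
  rw [Complex.conj_mul', Complex.conj_mul']
  exact_mod_cast hα

theorem norm_linearPoly {α : ℂ × ℂ} (hα : α ∈ sphere) : ‖linearPoly α‖ = 1 := by
  have hinner : inner ℂ (linearPoly α) (linearPoly α) = 1 := by
    rw [inner_linearPoly]
    simpa [coeff_linearPoly] using conj_mul_add_conj_mul_of_mem_sphere hα
  rw [norm_eq_sqrt_re_inner (𝕜 := ℂ), hinner, RCLike.one_re, Real.sqrt_one]

/-- The space `z² H²`, the largest subspace common to all the `H²_α`. -/
def sqShiftHardy : Submodule ℂ (LpT 2) := hardyAt (1, 0) ⊓ hardyAt (0, 1)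

theorem mem_sqShiftHardy {f : LpT 2} :
    f ∈ sqShiftHardy ↔ f ∈ hardy 2 ∧ coeff f 0 = 0 ∧ coeff f 1 = 0 := by
  simp only [sqShiftHardy, Submodule.mem_inf, mem_hardyAt, mul_zero, mul_one]
  tauto

instance completeSpace_sqShiftHardy : CompleteSpace sqShiftHardy :=
  ((isClosed_hardyAt (1, 0)).inter (isClosed_hardyAt (0, 1))).completeSpace_coe

theorem sqShiftHardy_le_hardyAt (α : ℂ × ℂ) : sqShiftHardy ≤ hardyAt α := fun f hf => by
  obtain ⟨hfH, hf0, hf1⟩ := mem_sqShiftHardy.1 hf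
  exact mem_hardyAt.2 ⟨hfH, by rw [hf0, hf1, zero_mul, zero_mul]⟩

theorem sqShiftHardy_isOrtho_span_linearPoly (α : ℂ × ℂ) :
    sqShiftHardy ⟂ ℂ ∙ linearPoly α := by
  rw [Submodule.isOrtho_comm, Submodule.isOrtho_iff_inner_eq]
  intro v hv f hf
  obtain ⟨c, rfl⟩ := Submodule.mem_span_singleton.1 hv
  obtain ⟨-, hf0, hf1⟩ := mem_sqShiftHardy.1 hf
  rw [inner_smul_left, inner_linearPoly, hf0, hf1, mul_zero, mul_zero, add_zero, mul_zero]

theorem sub_inner_smul_linearPoly_mem {α : ℂ × ℂ} (hα : α ∈ sphere) {f : LpT 2}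
    (hf : f ∈ hardyAt α) : f - inner ℂ (linearPoly α) f • linearPoly α ∈ sqShiftHardy := by
  have hunit := conj_mul_add_conj_mul_of_mem_sphere hα
  have hmem := sub_mem hf ((hardyAt α).smul_mem (inner ℂ (linearPoly α) f)
    (linearPoly_mem_hardyAt α))
  have hrel := (mem_hardyAt.1 hf).2
  refine mem_sqShiftHardy.2 ⟨(mem_hardyAt.1 hmem).1, ?_, ?_⟩
  all_goals
    rw [coeff_sub, coeff_smul, inner_linearPoly, coeff_linearPoly]
    simp only [if_true, zero_ne_one, one_ne_zero, if_false, mul_one, mul_zero, add_zero, zero_add]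
  · linear_combination (-coeff f 0) * hunit + (starRingEnd ℂ) α.2 * hrel
  · linear_combination (-coeff f 1) * hunit - (starRingEnd ℂ) α.1 * hrel

theorem sqShiftHardy_sup_span_linearPoly {α : ℂ × ℂ} (hα : α ∈ sphere) :
    sqShiftHardy ⊔ ℂ ∙ linearPoly α = hardyAt α := by
  refine le_antisymm (sup_le (sqShiftHardy_le_hardyAt α) ?_) fun f hf => ?_
  · exact (Submodule.span_singleton_le_iff_mem _ _).2 (linearPoly_mem_hardyAt α)
  · rw [← sub_add_cancel f (inner ℂ (linearPoly α) f • linearPoly α)]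
    exact Submodule.add_mem_sup (sub_inner_smul_linearPoly_mem hα hf)
      (Submodule.smul_mem _ _ (Submodule.mem_span_singleton_self _))

theorem starProjection_hardyAt {α : ℂ × ℂ} (hα : α ∈ sphere) :
    (hardyAt α).starProjection =
      sqShiftHardy.starProjection + (innerSL ℂ (linearPoly α)).smulRight (linearPoly α) := by
  rw [starProjection_eq_add_of_sup_eq (sqShiftHardy_isOrtho_span_linearPoly α)
    (sqShiftHardy_sup_span_linearPoly hα)]
  congr 1
  ext1 f
  exact Submodule.starProjection_unit_singleton ℂ (norm_linearPoly hα) f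

theorem continuousOn_starProjection_hardyAt :
    ContinuousOn (fun α => (hardyAt α).starProjection) sphere := by
  have hpoly : Continuous linearPoly := by unfold linearPoly; fun_prop
  have hrank : Continuous fun α => (innerSL ℂ (linearPoly α)).smulRight (linearPoly α) :=
    ((ContinuousLinearMap.smulRightL ℂ (LpT 2) (LpT 2)).continuous.comp
      ((innerSL ℂ).continuous.comp hpoly)).clm_apply hpoly
  exact (continuous_const.add hrank).continuousOn.congr fun α hα => starProjection_hardyAt hα

theorem continuousOn_hankel_hardyAt (A : LpT 2 →L[ℂ] LpT 2) :
    ContinuousOn (fun α => hankel (hardyAt α) A) sphere := by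
  have h := continuousOn_starProjection_hardyAt
  simp only [hankel, Submodule.starProjection_orthogonal]
  exact (continuousOn_const.sub h).clm_comp (continuousOn_const.clm_comp h)

theorem isCompact_sphere : IsCompact sphere := by
  refine Metric.isCompact_of_isClosed_isBounded (isClosed_eq (by fun_prop) continuous_const) ?_
  refine (Metric.isBounded_closedBall (x := (0 : ℂ × ℂ)) (r := 1)).subset fun α hα => ?_
  have hα' : ‖α.1‖ ^ 2 + ‖α.2‖ ^ 2 = 1 := hα
  rw [mem_closedBall_zero_iff, Prod.norm_def]
  refine max_le ?_ ?_ <;> nlinarith [sq_nonneg ‖α.1‖, sq_nonneg ‖α.2‖]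

theorem exists_norm_hankel_le {φ : LpT ∞} (hφ : ∀ᵐ t ∂arcLength, ‖φ t‖ = 1)
    (h : ∀ α ∈ sphere, ∃ S : hardyAt α →L[ℂ] hardyAt α, S * toeplitz α φ = 1) :
    ∃ r, 0 ≤ r ∧ r < 1 ∧ ∀ α ∈ sphere, ‖hankel (hardyAt α) (mulOp φ)‖ ≤ r := by
  have hne : sphere.Nonempty := ⟨(1, 0), by simp [sphere]⟩
  obtain ⟨α₀, hα₀, hmax⟩ := isCompact_sphere.exists_isMaxOn hne
    (continuousOn_hankel_hardyAt (mulOp φ)).norm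
  obtain ⟨S, hS⟩ := h α₀ hα₀
  exact ⟨_, norm_nonneg _, norm_hankel_lt_one (hardyAt α₀) (norm_mulOp_apply hφ) hS,
    fun α hα => hmax hα⟩

end UniformHankelBound

section DiscAlgebra

/-- A continuous function on the circle, as an element of `L^p`. -/
abbrev toLpT (p : ℝ≥0∞) [Fact (1 ≤ p)] : C(Torus, ℂ) →L[ℂ] LpT p :=
  ContinuousMap.toLp p arcLength ℂ

theorem toLpT_ae (p : ℝ≥0∞) [Fact (1 ≤ p)] (f : C(Torus, ℂ)) :
    (toLpT p f : Torus → ℂ) =ᵐ[arcLength] f :=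
  ContinuousMap.coeFn_toLp arcLength f

theorem norm_toLpT_congr {p : ℝ≥0∞} [Fact (1 ≤ p)] {f g : C(Torus, ℂ)}
    (h : ∀ t, ‖f t‖ = ‖g t‖) : ‖toLpT p f‖ = ‖toLpT p g‖ := by
  rw [Lp.norm_def, Lp.norm_def]
  refine congrArg ENNReal.toReal (eLpNorm_congr_norm_ae ?_)
  filter_upwards [toLpT_ae p f, toLpT_ae p g] with t hf hg
  rw [hf, hg, h]

theorem norm_toLpT_one (f : C(Torus, ℂ)) : ‖toLpT 1 f‖ = ∫ t, ‖f t‖ ∂arcLength := by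
  rw [L1.norm_eq_integral_norm]
  exact integral_congr_ae ((toLpT_ae 1 f).mono fun t ht => congrArg norm ht)

theorem norm_sq_toLpT_two (f : C(Torus, ℂ)) :
    ‖toLpT 2 f‖ ^ 2 = ∫ t, ‖f t‖ ^ 2 ∂arcLength := by
  have h : inner ℂ (toLpT 2 f) (toLpT 2 f) = ∫ t, ((‖f t‖ ^ 2 : ℝ) : ℂ) ∂arcLength := by
    rw [ContinuousMap.inner_toLp]
    exact integral_congr_ae (.of_forall fun t => by simp [Complex.mul_conj'])
  rw [inner_self_eq_norm_sq_to_K, integral_complex_ofReal] at h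
  exact Complex.ofReal_injective ((Complex.ofReal_pow _ _).trans h)

theorem mulOp_toLpT (f g : C(Torus, ℂ)) : mulOp (toLpT ∞ f) (toLpT 2 g) = toLpT 2 (f * g) := by
  refine Lp.ext ?_
  filter_upwards [mulOp_ae (toLpT ∞ f) (toLpT 2 g), toLpT_ae ∞ f, toLpT_ae 2 g,
    toLpT_ae 2 (f * g)] with t hmul hf hg hfg
  rw [hmul, hf, hg, hfg, ContinuousMap.mul_apply]

theorem toLpT_mem_hardy {p : ℝ≥0∞} [Fact (1 ≤ p)] {f : C(Torus, ℂ)} :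
    toLpT p f ∈ hardy p ↔ ∀ n < 0, fourierCoeff f n = 0 :=
  forall₂_congr fun n _ => by rw [coeff_toLp]

theorem fourierCoeff_one (n : ℤ) : fourierCoeff (1 : C(Torus, ℂ)) n = if n = 0 then 1 else 0 := by
  have hone : (1 : C(Torus, ℂ)) = fourier 0 := ContinuousMap.ext fun t => (fourier_zero).symm
  rw [hone, ← coeff_toLp (p := 2)]
  exact coeff_fourierLp 0 n

/-- The disc algebra: the continuous functions on the circle without negative frequencies. -/
def discAlgebra : Subalgebra ℂ C(Torus, ℂ) where
  carrier := {f | ∀ n < 0, fourierCoeff f n = 0}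
  mul_mem' := fun {f g} hf hg => toLpT_mem_hardy.1 <| by
    rw [← mulOp_toLpT]
    exact mulOp_mem_hardy (toLpT_mem_hardy.2 hf) (toLpT_mem_hardy.2 hg)
  add_mem' := fun {f g} hf hg => toLpT_mem_hardy.1 <| by
    rw [map_add (toLpT 2)]
    exact add_mem (toLpT_mem_hardy.2 hf) (toLpT_mem_hardy.2 hg)
  algebraMap_mem' := fun c => toLpT_mem_hardy.1 <| by
    rw [Algebra.algebraMap_eq_smul_one, map_smul (toLpT 2)]
    exact Submodule.smul_mem _ c (toLpT_mem_hardy.2 fun n hn => by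
      rw [fourierCoeff_one, if_neg hn.ne])

theorem toLpT_mem_hardy_of_mem {p : ℝ≥0∞} [Fact (1 ≤ p)] {f : C(Torus, ℂ)}
    (hf : f ∈ discAlgebra) : toLpT p f ∈ hardy p :=
  toLpT_mem_hardy.2 hf

theorem fourier_mem_discAlgebra {n : ℤ} (hn : 0 ≤ n) :
    (fourier n : C(Torus, ℂ)) ∈ discAlgebra :=
  toLpT_mem_hardy.1 (fourierLp_mem_hardy hn)

theorem isClosed_discAlgebra : IsClosed (discAlgebra : Set C(Torus, ℂ)) := by
  have h : (discAlgebra : Set C(Torus, ℂ)) =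
      ⋂ n : ℤ, ⋂ _ : n < 0, {f | coeffL 2 n (toLpT 2 f) = 0} := by
    ext f
    simp only [Set.mem_iInter, coeffL_apply, coeff_toLp]
    rfl
  rw [h]
  exact isClosed_iInter fun n => isClosed_iInter fun _ =>
    isClosed_eq ((coeffL 2 n).continuous.comp (toLpT 2).continuous) continuous_const

theorem exp_mem_discAlgebra {f : C(Torus, ℂ)} (hf : f ∈ discAlgebra) :
    NormedSpace.exp f ∈ discAlgebra :=
  isClosed_discAlgebra.mem_of_tendsto (NormedSpace.exp_series_hasSum_exp' (𝕂 := ℂ) f)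
    (.of_forall fun _ => sum_mem fun n _ => Subalgebra.smul_mem _ (pow_mem hf n) _)

theorem exp_apply (f : C(Torus, ℂ)) (t : Torus) : NormedSpace.exp f t = Complex.exp (f t) := by
  rw [Complex.exp_eq_exp_ℂ]
  exact NormedSpace.map_exp (ContinuousMap.evalAlgHom ℂ ℂ t) (continuous_eval_const t) f

theorem fourierCoeff_mul_zero {f g : C(Torus, ℂ)} (hf : f ∈ discAlgebra)
    (hg : g ∈ discAlgebra) :
    fourierCoeff (f * g : C(Torus, ℂ)) 0 = fourierCoeff g 0 * fourierCoeff f 0 := by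
  simpa only [mulOp_toLpT, coeff_toLp] using
    coeff_mulOp_zero (toLpT_mem_hardy_of_mem hf) (toLpT_mem_hardy_of_mem hg)

theorem fourierCoeff_mul_one {f g : C(Torus, ℂ)} (hf : f ∈ discAlgebra) (hg : g ∈ discAlgebra) :
    fourierCoeff (f * g : C(Torus, ℂ)) 1 =
      fourierCoeff g 0 * fourierCoeff f 1 + fourierCoeff g 1 * fourierCoeff f 0 := by
  simpa only [mulOp_toLpT, coeff_toLp] using
    coeff_mulOp_one (toLpT_mem_hardy_of_mem hf) (toLpT_mem_hardy_of_mem hg)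

theorem exists_eq_add_star_of_mem_span {s : C(Torus, ℂ)}
    (hs : s ∈ Submodule.span ℂ (Set.range (fourier (T := 2 * π)))) :
    ∃ f ∈ discAlgebra, ∃ g ∈ discAlgebra, s = f + star g := by
  induction hs using Submodule.span_induction with
  | mem x hx =>
    obtain ⟨n, rfl⟩ := hx
    rcases le_or_gt 0 n with hn | hn
    · exact ⟨_, fourier_mem_discAlgebra hn, 0, zero_mem _, by rw [star_zero, add_zero]⟩
    · refine ⟨0, zero_mem _, _, fourier_mem_discAlgebra (neg_nonneg.2 hn.le), ?_⟩
      ext t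
      simp
  | zero => exact ⟨0, zero_mem _, 0, zero_mem _, by rw [star_zero, add_zero]⟩
  | add x y _ _ hx hy =>
    obtain ⟨f, hf, g, hg, rfl⟩ := hx
    obtain ⟨f', hf', g', hg', rfl⟩ := hy
    exact ⟨f + f', add_mem hf hf', g + g', add_mem hg hg', by rw [star_add]; abel⟩
  | smul c x _ hx =>
    obtain ⟨f, hf, g, hg, rfl⟩ := hx
    exact ⟨c • f, Subalgebra.smul_mem _ hf c, star c • g, Subalgebra.smul_mem _ hg _, by
      rw [star_smul, star_star, smul_add]⟩

theorem exists_mem_discAlgebra_abs_re_sub_lt (u : C(Torus, ℝ)) {ε : ℝ} (hε : 0 < ε) :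
    ∃ f ∈ discAlgebra, ∀ t, |(f t).re - u t| < ε := by
  let U : C(Torus, ℂ) := ⟨fun t => (u t : ℂ), by fun_prop⟩
  have hU : U ∈ (Submodule.span ℂ (Set.range (fourier (T := 2 * π)))).topologicalClosure := by
    rw [span_fourier_closure_eq_top]
    trivial
  obtain ⟨s, hs, hsU⟩ := Metric.mem_closure_iff.1 hU ε hε
  obtain ⟨f, hf, g, hg, rfl⟩ := exists_eq_add_star_of_mem_span hs
  -- `f + conj g` and `f + g` have the same real part.
  refine ⟨f + g, add_mem hf hg, fun t => ?_⟩
  have hnorm : ‖(U - (f + star g)) t‖ < ε :=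
    (ContinuousMap.norm_coe_le_norm _ t).trans_lt (by rwa [← dist_eq_norm])
  rw [abs_sub_comm]
  simpa [U] using (Complex.abs_re_le_norm _).trans_lt hnorm

end DiscAlgebra

section Factorization

theorem exists_mul_eq_one_norm_sq_le {w : C(Torus, ℝ)} (hw : ∀ t, 0 < w t) {ε : ℝ}
    (hε : 0 < ε) :
    ∃ q ∈ discAlgebra, ∃ q' ∈ discAlgebra, q * q' = 1 ∧
      ∀ t, ‖q t‖ ^ 2 ≤ Real.exp ε * w t ∧ ‖q' t‖ ^ 2 ≤ Real.exp ε * (w t)⁻¹ := by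
  obtain ⟨f, hf, hfw⟩ := exists_mem_discAlgebra_abs_re_sub_lt
    ⟨fun t => Real.log (w t), w.continuous.log fun t => (hw t).ne'⟩ hε
  let g : C(Torus, ℂ) := (1 / 2 : ℂ) • f
  have hg : g ∈ discAlgebra := Subalgebra.smul_mem _ hf _
  refine ⟨_, exp_mem_discAlgebra hg, _, exp_mem_discAlgebra (neg_mem hg), ?_, fun t => ?_⟩
  · ext t
    rw [ContinuousMap.mul_apply, exp_apply, exp_apply, ContinuousMap.neg_apply, ← Complex.exp_add,
      add_neg_cancel, Complex.exp_zero, ContinuousMap.one_apply]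
  have hre : 2 * (g t).re = (f t).re := by simp [g]
  have hlog : |(f t).re - Real.log (w t)| < ε := hfw t
  obtain ⟨hlower, hupper⟩ := abs_lt.1 hlog
  constructor
  · calc ‖NormedSpace.exp g t‖ ^ 2 = Real.exp (f t).re := by
          rw [exp_apply, Complex.norm_exp, ← Real.exp_nat_mul, Nat.cast_two, hre]
      _ ≤ Real.exp (ε + Real.log (w t)) := Real.exp_le_exp.2 (by linarith)
      _ = Real.exp ε * w t := by rw [Real.exp_add, Real.exp_log (hw t)]
  · calc ‖NormedSpace.exp (-g) t‖ ^ 2 = Real.exp (-(f t).re) := by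
          rw [exp_apply, Complex.norm_exp, ← Real.exp_nat_mul, Nat.cast_two,
            ContinuousMap.neg_apply, Complex.neg_re, mul_neg, hre]
      _ ≤ Real.exp (ε - Real.log (w t)) := Real.exp_le_exp.2 (by linarith)
      _ = Real.exp ε * (w t)⁻¹ := by
          rw [sub_eq_add_neg, ← Real.log_inv, Real.exp_add, Real.exp_log (inv_pos.2 (hw t))]

theorem norm_sq_toLpT_le_of_norm_sq_le {f h : C(Torus, ℂ)} {a ε : ℝ}
    (hle : ∀ t, ‖f t‖ ^ 2 ≤ a * (‖h t‖ + ε)) :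
    ‖toLpT 2 f‖ ^ 2 ≤ a * (‖toLpT 1 h‖ + ε) := by
  have hint {g : Torus → ℝ} (hg : Continuous g) : Integrable g arcLength :=
    hg.integrable_of_hasCompactSupport (.of_compactSpace g)
  calc ‖toLpT 2 f‖ ^ 2 = ∫ t, ‖f t‖ ^ 2 ∂arcLength := norm_sq_toLpT_two f
    _ ≤ ∫ t, a * (‖h t‖ + ε) ∂arcLength :=
        integral_mono (hint (by fun_prop)) (hint (by fun_prop)) hle
    _ = a * (‖toLpT 1 h‖ + ε) := by
        rw [integral_const_mul, integral_add (hint (by fun_prop)) (integrable_const ε),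
          norm_toLpT_one, integral_const, probReal_univ, one_smul]

theorem exists_factorization {h : C(Torus, ℂ)} (hh : h ∈ discAlgebra) {ε : ℝ} (hε : 0 < ε) :
    ∃ c ∈ discAlgebra, ∃ q ∈ discAlgebra, c * q = h ∧ fourierCoeff q 0 ≠ 0 ∧
      ‖toLpT 2 c‖ ^ 2 ≤ Real.exp ε * (‖toLpT 1 h‖ + ε) ∧
      ‖toLpT 2 q‖ ^ 2 ≤ Real.exp ε * (‖toLpT 1 h‖ + ε) := by
  have hpos (t : Torus) : 0 < ‖h t‖ + ε := by positivity
  obtain ⟨q, hq, q', hq', hqq', hle⟩ :=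
    exists_mul_eq_one_norm_sq_le (w := ⟨fun t => ‖h t‖ + ε, by fun_prop⟩) hpos hε
  refine ⟨h * q', mul_mem hh hq', q, hq, ?_, fun hq0 => ?_,
    norm_sq_toLpT_le_of_norm_sq_le fun t => ?_, norm_sq_toLpT_le_of_norm_sq_le fun t => (hle t).1⟩
  · rw [mul_assoc, mul_comm q', hqq', mul_one]
  · have hmul := fourierCoeff_mul_zero hq hq'
    rw [hqq', fourierCoeff_one, if_pos rfl, hq0, mul_zero] at hmul
    exact one_ne_zero hmul
  · calc ‖(h * q') t‖ ^ 2 = ‖h t‖ ^ 2 * ‖q' t‖ ^ 2 := by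
          rw [ContinuousMap.mul_apply, norm_mul, mul_pow]
      _ ≤ (‖h t‖ + ε) ^ 2 * (Real.exp ε * (‖h t‖ + ε)⁻¹) := by
          gcongr
          · linarith
          · exact (hle t).2
      _ = Real.exp ε * (‖h t‖ + ε) := by
          field_simp [(hpos t).ne']

end Factorization

section HankelForm

theorem hardyAt_smul {c : ℂ} (hc : c ≠ 0) (α : ℂ × ℂ) : hardyAt (c • α) = hardyAt α := by
  ext f
  rw [mem_hardyAt, mem_hardyAt, Prod.smul_fst, Prod.smul_snd, smul_eq_mul, smul_eq_mul,
    mul_left_comm, mul_left_comm _ c, mul_right_inj' hc]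

theorem exists_mem_sphere_hardyAt_eq {α : ℂ × ℂ} (hα : α ≠ 0) :
    ∃ β ∈ sphere, hardyAt β = hardyAt α := by
  have hpos : 0 < ‖α.1‖ ^ 2 + ‖α.2‖ ^ 2 := by
    rcases not_and_or.1 (mt Prod.ext_iff.2 hα) with h | h <;>
    · have := norm_pos_iff.2 h
      positivity
  set N : ℝ := √(‖α.1‖ ^ 2 + ‖α.2‖ ^ 2)
  have hN : N ^ 2 = ‖α.1‖ ^ 2 + ‖α.2‖ ^ 2 := Real.sq_sqrt hpos.le
  have hN0 : N ≠ 0 := (Real.sqrt_pos.2 hpos).ne'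
  refine ⟨(N⁻¹ : ℂ) • α, ?_, hardyAt_smul (inv_ne_zero (Complex.ofReal_ne_zero.2 hN0)) α⟩
  change ‖(N⁻¹ : ℂ) * α.1‖ ^ 2 + ‖(N⁻¹ : ℂ) * α.2‖ ^ 2 = 1
  rw [norm_mul, norm_mul, mul_pow, mul_pow, ← mul_add, ← hN, norm_inv, Complex.norm_real,
    Real.norm_eq_abs, inv_pow, sq_abs, inv_mul_cancel₀ (pow_ne_zero 2 hN0)]

theorem inner_toLpT_fourier_one_mul_star (c : C(Torus, ℂ)) (f : LpT 2) :
    inner ℂ (toLpT 2 (fourier 1 * star c)) f = coeff (mulOp (toLpT ∞ c) f) 1 := by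
  rw [L2.inner_def]
  unfold coeff fourierCoeff
  refine integral_congr_ae ?_
  filter_upwards [toLpT_ae 2 (fourier 1 * star c), mulOp_ae (toLpT ∞ c) f, toLpT_ae ∞ c]
    with t hzc hmul hc
  rw [hzc, hmul, hc, fourier_neg]
  simp [mul_comm, mul_left_comm]

theorem inner_mulOp_toLpT (φ : LpT ∞) (c q : C(Torus, ℂ)) :
    inner ℂ (toLpT 2 (fourier 1 * star c)) (mulOp φ (toLpT 2 q)) =
      pairing φ (toLpT 1 (fourier (-1) * (c * q))) := by
  rw [inner_toLpT_fourier_one_mul_star, pairing_apply]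
  unfold coeff fourierCoeff
  refine integral_congr_ae ?_
  filter_upwards [mulOp_ae (toLpT ∞ c) (mulOp φ (toLpT 2 q)), toLpT_ae ∞ c,
    mulOp_ae φ (toLpT 2 q), toLpT_ae 2 q, toLpT_ae 1 (fourier (-1) * (c * q))]
    with t hcφq hc hφq hq hzcq
  rw [hcφq, hc, hφq, hq, hzcq, ContinuousMap.mul_apply, ContinuousMap.mul_apply, smul_eq_mul]
  ring

theorem toLpT_mem_hardyAt {q : C(Torus, ℂ)} (hq : q ∈ discAlgebra) :
    toLpT 2 q ∈ hardyAt (fourierCoeff q 0, fourierCoeff q 1) :=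
  mem_hardyAt.2 ⟨toLpT_mem_hardy_of_mem hq, by rw [coeff_toLp, coeff_toLp, mul_comm]⟩

theorem toLpT_fourier_one_mul_star_mem_orthogonal {c q : C(Torus, ℂ)} (hc : c ∈ discAlgebra)
    (hq : q ∈ discAlgebra) (hq0 : fourierCoeff q 0 ≠ 0)
    (hcq : fourierCoeff (c * q : C(Torus, ℂ)) 1 = 0) :
    toLpT 2 (fourier 1 * star c) ∈ (hardyAt (fourierCoeff q 0, fourierCoeff q 1))ᗮ := by
  rw [Submodule.mem_orthogonal']
  intro f hf
  obtain ⟨hfH, hf⟩ := mem_hardyAt.1 hf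
  rw [fourierCoeff_mul_one hc hq] at hcq
  rw [inner_toLpT_fourier_one_mul_star, coeff_mulOp_one (toLpT_mem_hardy_of_mem hc) hfH,
    coeff_toLp, coeff_toLp]
  apply mul_left_cancel₀ hq0
  linear_combination coeff f 0 * hcq - fourierCoeff c 0 * hf

variable {φ : LpT ∞} {r : ℝ}

theorem norm_pairing_mul_le (H : ∀ α ∈ sphere, ‖hankel (hardyAt α) (mulOp φ)‖ ≤ r)
    {c q : C(Torus, ℂ)} (hc : c ∈ discAlgebra) (hq : q ∈ discAlgebra)
    (hq0 : fourierCoeff q 0 ≠ 0) (hcq : fourierCoeff (c * q : C(Torus, ℂ)) 1 = 0) :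
    ‖pairing φ (toLpT 1 (fourier (-1) * (c * q)))‖ ≤ r * ‖toLpT 2 c‖ * ‖toLpT 2 q‖ := by
  have hα : (fourierCoeff q 0, fourierCoeff q 1) ≠ (0 : ℂ × ℂ) :=
    fun h => hq0 (congrArg Prod.fst h)
  obtain ⟨β, hβ, hβα⟩ := exists_mem_sphere_hardyAt_eq hα
  have hmem := toLpT_mem_hardyAt hq
  have horth := toLpT_fourier_one_mul_star_mem_orthogonal hc hq hq0 hcq
  rw [← hβα] at hmem horth
  have hnorm : ‖toLpT 2 (fourier 1 * star c)‖ = ‖toLpT 2 c‖ :=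
    norm_toLpT_congr fun t => by simp [Circle.norm_coe]
  calc ‖pairing φ (toLpT 1 (fourier (-1) * (c * q)))‖
      = ‖inner ℂ (toLpT 2 (fourier 1 * star c)) (mulOp φ (toLpT 2 q))‖ := by
        rw [inner_mulOp_toLpT]
    _ ≤ ‖hankel (hardyAt β) (mulOp φ)‖ * ‖toLpT 2 q‖ * ‖toLpT 2 c‖ :=
        hnorm ▸ norm_inner_le_norm_hankel (hardyAt β) (mulOp φ) hmem horth
    _ ≤ r * ‖toLpT 2 q‖ * ‖toLpT 2 c‖ := by gcongr; exact H β hβ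
    _ = r * ‖toLpT 2 c‖ * ‖toLpT 2 q‖ := mul_right_comm _ _ _

theorem norm_pairing_le (hr : 0 ≤ r) (H : ∀ α ∈ sphere, ‖hankel (hardyAt α) (mulOp φ)‖ ≤ r)
    {h : C(Torus, ℂ)} (hh : h ∈ discAlgebra) (h1 : fourierCoeff h 1 = 0) :
    ‖pairing φ (toLpT 1 (fourier (-1) * h))‖ ≤ r * ‖toLpT 1 h‖ := by
  have hbound (ε : ℝ) (hε : 0 < ε) : ‖pairing φ (toLpT 1 (fourier (-1) * h))‖ ≤
      r * (Real.exp ε * (‖toLpT 1 h‖ + ε)) := by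
    obtain ⟨c, hc, q, hq, rfl, hq0, hcnorm, hqnorm⟩ := exists_factorization hh hε
    refine (norm_pairing_mul_le H hc hq hq0 h1).trans ?_
    rw [mul_assoc]
    refine mul_le_mul_of_nonneg_left ?_ hr
    linarith [two_mul_le_add_sq ‖toLpT 2 c‖ ‖toLpT 2 q‖]
  have hlim : Filter.Tendsto (fun ε : ℝ => r * (Real.exp ε * (‖toLpT 1 h‖ + ε)))
      (nhdsWithin 0 (Set.Ioi 0)) (nhds (r * (Real.exp 0 * (‖toLpT 1 h‖ + 0)))) :=
    (Continuous.tendsto (by fun_prop) 0).mono_left nhdsWithin_le_nhds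
  rw [Real.exp_zero, one_mul, add_zero] at hlim
  exact ge_of_tendsto hlim (Filter.eventually_of_mem self_mem_nhdsWithin hbound)

end HankelForm

section Distance

/-- The continuous elements `h` of the Neil algebra, that is, the `h` in the disc algebra with
`h'(0) = 0`. The functions `z̄ h` annihilate `𝔄` under the pairing of `L^∞` with `L¹`. -/
def discNeil : Submodule ℂ C(Torus, ℂ) :=
  Subalgebra.toSubmodule discAlgebra ⊓ ((coeffL 2 1).comp (toLpT 2)).ker

theorem mem_discNeil {h : C(Torus, ℂ)} :
    h ∈ discNeil ↔ h ∈ discAlgebra ∧ fourierCoeff h 1 = 0 := by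
  rw [← coeff_toLp (p := 2)]
  rfl

theorem fourier_mem_discNeil {n : ℤ} (h0 : 0 ≤ n) (h1 : n ≠ 1) :
    (fourier n : C(Torus, ℂ)) ∈ discNeil :=
  mem_discNeil.2 ⟨fourier_mem_discAlgebra h0, by
    rw [← coeff_toLp (p := 2)]
    exact (coeff_fourierLp n 1).trans (if_neg h1.symm)⟩

theorem pairing_fourier (φ : LpT ∞) (n : ℤ) :
    pairing φ (toLpT 1 (fourier (-1) * fourier n)) = coeff φ (1 - n) := by
  rw [pairing_apply]
  unfold coeff fourierCoeff
  refine integral_congr_ae ?_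
  filter_upwards [toLpT_ae 1 (fourier (-1) * fourier n)] with t ht
  rw [ht, ContinuousMap.mul_apply, ← fourier_add, smul_eq_mul, mul_comm, neg_sub, neg_add_eq_sub]

theorem mem_neil_of_pairing_eq_zero {ψ : LpT ∞}
    (h : ∀ f ∈ discNeil, pairing ψ (toLpT 1 (fourier (-1) * f)) = 0) : ψ ∈ neil := by
  have hcoeff (n : ℤ) (hn : n ≤ 1) (hn0 : n ≠ 0) : coeff ψ n = 0 := by
    rw [← sub_sub_cancel 1 n, ← pairing_fourier]
    exact h _ (fourier_mem_discNeil (by lia) (by lia))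
  exact mem_neil.2 ⟨fun n hn => hcoeff n (by lia) hn.ne, hcoeff 1 le_rfl one_ne_zero⟩

variable {φ : LpT ∞}

theorem exists_mem_neil_norm_sub_le {r : ℝ} (hr : 0 ≤ r)
    (H : ∀ α ∈ sphere, ‖hankel (hardyAt α) (mulOp φ)‖ ≤ r) : ∃ ψ ∈ neil, ‖φ - ψ‖ ≤ r := by
  let Φ : C(Torus, ℂ) →ₗ[ℂ] LpT 1 := (toLpT 1).toLinearMap ∘ₗ LinearMap.mulLeft ℂ (fourier (-1))
  have hbound : ∀ w ∈ discNeil.map Φ, ‖pairing φ w‖ ≤ r * ‖w‖ := by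
    rintro _ ⟨h, hh, rfl⟩
    obtain ⟨hA, h1⟩ := mem_discNeil.1 hh
    have hnorm : ‖toLpT 1 (fourier (-1) * h)‖ = ‖toLpT 1 h‖ :=
      norm_toLpT_congr fun t => by simp [Circle.norm_coe]
    exact (norm_pairing_le hr H hA h1).trans_eq (by rw [← hnorm]; rfl)
  obtain ⟨ψ, hle, hψ⟩ := exists_norm_sub_le_pairing_eq_zero φ (discNeil.map Φ) hr hbound
  exact ⟨ψ, mem_neil_of_pairing_eq_zero fun f hf => hψ _ (Submodule.mem_map_of_mem hf), hle⟩

theorem exists_mem_neil_norm_sub_lt_one (hφ : ∀ᵐ t ∂arcLength, ‖φ t‖ = 1)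
    (h : ∀ α ∈ sphere, ∃ S : hardyAt α →L[ℂ] hardyAt α, S * toeplitz α φ = 1) :
    ∃ ψ ∈ neil, ‖φ - ψ‖ < 1 := by
  obtain ⟨r, hr0, hr1, H⟩ := exists_norm_hankel_le hφ h
  obtain ⟨ψ, hψ, hle⟩ := exists_mem_neil_norm_sub_le hr0 H
  exact ⟨ψ, hψ, hle.trans_lt hr1⟩

end Distance

end

end NeilAlgebra

theorem mainTheorem2 (φ : NeilAlgebra.LpT ∞)
    (hφ : ∀ᵐ t ∂NeilAlgebra.arcLength, ‖φ t‖ = 1) :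
    (Metric.infDist φ (NeilAlgebra.neil : Set (NeilAlgebra.LpT ∞)) < 1 ↔
      ∀ α ∈ NeilAlgebra.sphere,
        ∃ S : NeilAlgebra.hardyAt α →L[ℂ] NeilAlgebra.hardyAt α,
          S.comp (NeilAlgebra.toeplitz α φ) = ContinuousLinearMap.id ℂ _) ∧
    (Metric.infDist φ NeilAlgebra.neilInvertible < 1 ↔
      ∀ α ∈ NeilAlgebra.sphere,
        ∃ S : NeilAlgebra.hardyAt α →L[ℂ] NeilAlgebra.hardyAt α,
          S.comp (NeilAlgebra.toeplitz α φ) = ContinuousLinearMap.id ℂ _ ∧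
          (NeilAlgebra.toeplitz α φ).comp S = ContinuousLinearMap.id ℂ _) := by
  constructor
  · rw [Metric.infDist_lt_iff ⟨0, zero_mem _⟩]
    simp only [dist_eq_norm]
    refine ⟨?_, NeilAlgebra.exists_mem_neil_norm_sub_lt_one hφ⟩
    rintro ⟨ψ, hψ, hlt⟩ α -
    exact NeilAlgebra.exists_leftInverse_toeplitz hφ α hψ hlt
  · rw [Metric.infDist_lt_iff ⟨_, NeilAlgebra.const_one_mem_neilInvertible⟩]
    simp only [dist_eq_norm]
    constructor
    · rintro ⟨ψ, hψ, hlt⟩ α -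
      have hT := (NeilAlgebra.isUnit_toeplitz_iff_of_norm_sub_lt_one hφ α hψ.1 hlt).2
        (NeilAlgebra.isUnit_toeplitz_of_mem_neilInvertible α hψ)
      obtain ⟨S, hS⟩ := isUnit_iff_exists.1 hT
      exact ⟨S, hS.2, hS.1⟩
    · intro h
      obtain ⟨ψ, hψ, hlt⟩ := NeilAlgebra.exists_mem_neil_norm_sub_lt_one hφ fun α hα =>
        (h α hα).imp fun S hS => hS.1
      obtain ⟨S, hS1, hS2⟩ := h (1, 0) (by simp [NeilAlgebra.sphere])
      have hT := (NeilAlgebra.isUnit_toeplitz_iff_of_norm_sub_lt_one hφ (1, 0) hψ hlt).1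
        (isUnit_iff_exists.2 ⟨S, hS2, hS1⟩)
      exact ⟨ψ, NeilAlgebra.mem_neilInvertible_of_isUnit_toeplitz hφ hψ hlt hT, hlt⟩
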